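/- For $x,y\in(0,1)$ put $$D(x,y)=\frac{\sqrt{\Gamma(2x+1)\,\Gamma(2y+1)\,\sin(\pi x)\,\sin(\pi y)}}{2\,\Gamma(x+y+1)\,\sin\!\big(\tfrac{\pi(x+y)}{2}\big)}.$$ Let $K\in(0,1]$, let $0<\mu\le\nu<1$, and let $H:[0,\infty)\to[\mu,\nu]$ be Hölder continuous with exponent $\beta>0$, where $\sup_{t\ge 0}H(t)<\beta$. Let $B^{H(\cdot),K}=(B^{H(t),K}_t)_{t\ge 0}$ be a centred Gaussian process with covariance function $$R^{H(\cdot),K}(t,s)=D(H(t),H(s))^{K}\Big[\big(t^{H(t)+H(s)}+s^{H(t)+H(s)}\big)^{K}-|t-s|^{(H(t)+H(s))K}\Big],\qquad t,s\ge 0.$$ Then $B^{H(\cdot),K}$ is locally asymptotically self-similar: for every $t>0$ (and also for $t=0$ if $K=1$), as $\rho\to 0^+$, $$\left(\frac{B^{H(t+\rho u),K}_{t+\rho u}-B^{H(t),K}_t}{\rho^{H(t)K}}\right)_{u\ge 0}\longrightarrow\Big(2^{(1-K)/2}\,B^{H(t)K}_u\Big)_{u\ge 0}$$ in the sense of convergence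 of finite-dimensional distributions, where $B^{H(t)K}$ is a fractional Brownian motion with Hurst parameter $h=H(t)K$, that is, a centred Gaussian process with covariance function $\tfrac12\big(u^{2h}+v^{2h}-|u-v|^{2h}\big)$, $u,v\ge 0$. -/

import Mathlib

open MeasureTheory ProbabilityTheory Filter Topology
open scoped NNReal

/-- `Z` is a centred Gaussian process indexed by `[0, ∞)` with covariance function `R`. -/
structure IsCentredGaussian {Ω : Type*} [MeasurableSpace Ω] (R : ℝ≥0 → ℝ≥0 → ℝ)
    (Z : ℝ≥0 → Ω → ℝ) (P : Measure Ω) : Prop where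
  gaussian : IsGaussianProcess Z P
  centred : ∀ t, ∫ ω, Z t ω ∂P = 0
  cov_eq : ∀ t s, cov[Z t, Z s; P] = R t s

/-- The covariance function of fractional Brownian motion with Hurst parameter `h`. -/
noncomputable def fbmCov (h : ℝ) (t s : ℝ≥0) : ℝ :=
  1 / 2 * ((t : ℝ) ^ (2 * h) + (s : ℝ) ^ (2 * h) - |(t : ℝ) - s| ^ (2 * h))

/-- Fractional Brownian motion with Hurst parameter `h`, in the sense of finite-dimensional
distributions. -/
def IsFBm {Ω : Type*} [MeasurableSpace Ω] (h : ℝ) (Z : ℝ≥0 → Ω → ℝ) (P : Measure Ω) : Prop :=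
  IsCentredGaussian (fbmCov h) Z P

/-- The normalising factor `D(x, y)` in the covariance of standard multifractional Brownian
motion. -/
noncomputable def mbmD (x y : ℝ) : ℝ :=
  √((Real.Gamma (2 * x + 1) * Real.Gamma (2 * y + 1)) *
      Real.sin (Real.pi * x) * Real.sin (Real.pi * y)) /
    (2 * Real.Gamma (x + y + 1) * Real.sin (Real.pi * (x + y) / 2))

/-- The covariance function `R^{H(·),K}`. -/
noncomputable def bmbmCov (H : ℝ≥0 → ℝ) (K : ℝ) (t s : ℝ≥0) : ℝ :=
  mbmD (H t) (H s) ^ K *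
    (((t : ℝ) ^ (H t + H s) + (s : ℝ) ^ (H t + H s)) ^ K
      - |(t : ℝ) - s| ^ ((H t + H s) * K))

/-- `B` is the process `B^{H(·),K}`: the centred Gaussian process with covariance `R^{H(·),K}`.
It vanishes almost surely at time `0`, because its variance there is `0`. -/
def IsBMBm {Ω : Type*} [MeasurableSpace Ω] (H : ℝ≥0 → ℝ) (K : ℝ) (B : ℝ≥0 → Ω → ℝ)
    (P : Measure Ω) : Prop :=
  IsCentredGaussian (bmbmCov H K) B P

/-- The processes `X ρ` converge to `Z` along the filter `l` in the sense of finite-dimensional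
distributions. -/
def TendstoFDD {ι T Ω Ω' : Type*} [MeasurableSpace Ω] [MeasurableSpace Ω']
    (X : ι → T → Ω → ℝ) (l : Filter ι) (Z : T → Ω' → ℝ)
    (P : Measure Ω) [IsProbabilityMeasure P] (P' : Measure Ω') [IsProbabilityMeasure P'] : Prop :=
  ∀ I : Finset T, TendstoInDistribution (fun ρ ω ↦ I.restrict (X ρ · ω)) l
    (fun ω ↦ I.restrict (Z · ω)) (fun _ ↦ P) P'

/-!
Both processes are centred Gaussian, so by Lévy's continuity theorem it is enough that the
covariances of the rescaled increments converge (`tendstoFDD_of_tendsto_covariance`), and by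
polarisation that the rescaled variances `Var (B_a - B_b) / ρ ^ (2 H(t) K)` do, for `a = t + ρ u` and
`b = t + ρ v` (`tendsto_bmbmCov_variogram`).

With `x = H(a)` and `y = H(b)`, and since `D(x, x) = 1 / 2`, this variance is the sum of the
increment term `2 D(x, y) ^ K |a - b| ^ ((x + y) K)` and the remainder
`a ^ (2 x K) + b ^ (2 y K) - 2 D(x, y) ^ K (a ^ (x + y) + b ^ (x + y)) ^ K`.

The increment term gives the limit. Its constant tends to `2 ^ (1 - K)`, and the error
`(x + y) K - 2 H(t) K = O(ρ ^ β)` in the exponent is harmless because `ρ ^ β log ρ → 0`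
(`tendsto_mul_rpow_div_rpow`).

For `t > 0` the remainder is a smooth function of `((a, x), (b, y))` which is symmetric under the
exchange of the two pairs and vanishes when they agree. Its derivative is therefore zero on the
diagonal (`fderiv_eq_zero_of_symm_of_diag`), and it is quadratically small there
(`bmbmRemainder_isBigO`), hence `O(ρ ^ (2 min(1, β)))`. This is `o(ρ ^ (2 H(t) K))`, which is where
`H(t) < β` enters. For `t = 0` and `K = 1` the powers are not smooth, but the rescaled terms of the
remainder converge one by one and their limits cancel (`tendsto_bmbmRemainder_zero`).
-/

/-! ### Convergence of Gaussian processes from their covariances -/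

/-- The law is carried to the Euclidean space because `charFun` needs an inner product, which the
sup-normed `ι → ℝ` lacks. -/
lemma ProbabilityTheory.HasGaussianLaw.charFun_toLp_map {ι Ω : Type*} [Fintype ι]
    [MeasurableSpace Ω] {P : Measure Ω} [IsProbabilityMeasure P] {X : Ω → ι → ℝ}
    (hX : HasGaussianLaw X P) (hX0 : ∀ i, ∫ ω, X ω i ∂P = 0) (ξ : EuclideanSpace ℝ ι) :
    charFun (P.map (fun ω ↦ WithLp.toLp 2 (X ω))) ξ =
      Complex.exp (-((∑ i, ∑ j, ξ i * ξ j * cov[fun ω ↦ X ω i, fun ω ↦ X ω j; P] : ℝ) : ℂ) / 2) := by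
  have hL : ∀ i, MemLp (fun ω ↦ X ω i) 2 P := fun i ↦ (hX.eval i).memLp_two
  have hinner : (fun ω ↦ inner ℝ ξ (WithLp.toLp 2 (X ω))) = fun ω ↦ ∑ i, ξ i * X ω i := by
    ext ω; simp [PiLp.inner_apply, mul_comm]
  have hmean : ∫ ω, ∑ i, ξ i * X ω i ∂P = 0 := by
    rw [integral_finsetSum _ fun i _ ↦ ((hL i).integrable (by norm_num)).const_mul _]
    simp [integral_const_mul, hX0]
  have hvar : Var[fun ω ↦ ∑ i, ξ i * X ω i; P] =
      ∑ i, ∑ j, ξ i * ξ j * cov[fun ω ↦ X ω i, fun ω ↦ X ω j; P] := by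
    rw [variance_fun_sum fun i ↦ (hL i).const_mul _]
    refine Finset.sum_congr rfl fun i _ ↦ Finset.sum_congr rfl fun j _ ↦ ?_
    rw [covariance_const_mul_left, covariance_const_mul_right, mul_assoc]
  rw [(hX.toLp_pi 2).charFun_map_eq, hinner, hmean, hvar]
  congr 1
  simp [neg_div]

/-- For centred Gaussian processes, convergence of the covariance functions gives convergence of the
finite-dimensional distributions, by Lévy's continuity theorem. -/
theorem tendstoFDD_of_tendsto_covariance {ι T Ω Ω' : Type*} [MeasurableSpace Ω]
    [MeasurableSpace Ω'] {P : Measure Ω} [IsProbabilityMeasure P] {P' : Measure Ω'}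
    [IsProbabilityMeasure P'] {X : ι → T → Ω → ℝ} {Z : T → Ω' → ℝ} {l : Filter ι}
    [l.IsCountablyGenerated] (hX : ∀ i, IsGaussianProcess (X i) P)
    (hX0 : ∀ i s, ∫ ω, X i s ω ∂P = 0) (hZ : IsGaussianProcess Z P')
    (hZ0 : ∀ s, ∫ ω, Z s ω ∂P' = 0)
    (hcov : ∀ s r, Tendsto (fun i ↦ cov[X i s, X i r; P]) l (𝓝 cov[Z s, Z r; P'])) :
    TendstoFDD X l Z P P' := by
  intro I
  have hXm : ∀ i, AEMeasurable (fun ω ↦ WithLp.toLp 2 (I.restrict (X i · ω))) P := fun i ↦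
    (((hX i).hasGaussianLaw I).toLp_pi 2).aemeasurable
  have hZm : AEMeasurable (fun ω ↦ WithLp.toLp 2 (I.restrict (Z · ω))) P' :=
    ((hZ.hasGaussianLaw I).toLp_pi 2).aemeasurable
  have key : TendstoInDistribution (fun i ω ↦ WithLp.toLp 2 (I.restrict (X i · ω))) l
      (fun ω ↦ WithLp.toLp 2 (I.restrict (Z · ω))) (fun _ ↦ P) P' := by
    -- Lévy's theorem concerns sequences, so the countably generated filter is tested along them.
    refine ⟨hXm, hZm, tendsto_of_seq_tendsto fun k hk ↦ ?_⟩
    refine ProbabilityMeasure.tendsto_iff_tendsto_charFun.2 fun ξ ↦ ?_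
    change Tendsto (fun n ↦ charFun (P.map fun ω ↦ WithLp.toLp 2 (I.restrict (X (k n) · ω))) ξ)
      atTop (𝓝 (charFun (P'.map fun ω ↦ WithLp.toLp 2 (I.restrict (Z · ω))) ξ))
    simp_rw [((hX _).hasGaussianLaw I).charFun_toLp_map (fun s ↦ hX0 _ s) ξ]
    rw [(hZ.hasGaussianLaw I).charFun_toLp_map (fun s ↦ hZ0 s) ξ]
    refine (Complex.continuous_exp.tendsto _).comp (Tendsto.div_const (Tendsto.neg ?_) _)
    refine (Complex.continuous_ofReal.tendsto _).comp ?_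
    refine tendsto_finsetSum _ fun s _ ↦ tendsto_finsetSum _ fun r _ ↦ Tendsto.const_mul _ ?_
    exact (hcov s r).comp hk
  exact key.continuous_comp (g := WithLp.ofLp) (PiLp.continuous_ofLp 2 _)

/-! ### Second-order vanishing on the diagonal -/

open Asymptotics in
/-- A `C²` function is quadratically small near a critical zero: its derivative is
`O(‖q - p‖)`, and the mean value inequality on the ball of radius `‖q - p‖` gains the other
factor. -/
lemma ContDiffAt.isBigO_norm_sub_sq {E : Type*} [NormedAddCommGroup E] [NormedSpace ℝ E]
    {f : E → ℝ} {p : E} (hf : ContDiffAt ℝ 2 f p) (h0 : f p = 0) (h1 : fderiv ℝ f p = 0) :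
    f =O[𝓝 p] fun q ↦ ‖q - p‖ ^ 2 := by
  have hd : ∀ᶠ q in 𝓝 p, DifferentiableAt ℝ f q :=
    (hf.eventually (by simp)).mono fun q hq ↦ hq.differentiableAt (by simp)
  have hf' : (fderiv ℝ f) =O[𝓝 p] fun q ↦ q - p := by
    have := ((hf.fderiv_right (m := 1) (by norm_num)).differentiableAt (by simp)).isBigO_sub
    simpa [h1] using this
  obtain ⟨C, hC⟩ := hf'.bound
  obtain ⟨r, hr, hball⟩ := Metric.eventually_nhds_iff_ball.1 (hd.and hC)
  refine IsBigO.of_bound C ?_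
  filter_upwards [Metric.ball_mem_nhds p hr] with q hq
  have hsub : ∀ z ∈ Metric.closedBall p ‖q - p‖, z ∈ Metric.ball p r := fun z hz ↦
    lt_of_le_of_lt (Metric.mem_closedBall.1 hz) (by simpa [dist_eq_norm] using hq)
  have hC0 : 0 ≤ C * ‖q - p‖ := (norm_nonneg _).trans (hball q hq).2
  have hle : ∀ z ∈ Metric.closedBall p ‖q - p‖, ‖fderiv ℝ f z‖ ≤ C * ‖q - p‖ := by
    intro z hz
    have hzp : ‖z - p‖ ≤ ‖q - p‖ := by simpa [dist_eq_norm] using hz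
    -- Monotonicity needs `0 ≤ C`, which `hC0` gives only when `q ≠ p`.
    rcases (norm_nonneg (q - p)).eq_or_lt with h | h
    · refine (hball z (hsub z hz)).2.trans ?_
      rw [← h] at hzp ⊢
      simp [le_antisymm hzp (norm_nonneg _)]
    · exact (hball z (hsub z hz)).2.trans
        (mul_le_mul_of_nonneg_left hzp (nonneg_of_mul_nonneg_left hC0 h))
  have := (convex_closedBall p ‖q - p‖).norm_image_sub_le_of_norm_fderiv_le (𝕜 := ℝ)
    (fun z hz ↦ (hball z (hsub z hz)).1) hle (Metric.mem_closedBall_self (norm_nonneg _))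
    (show q ∈ _ by simp [dist_eq_norm])
  simpa [h0, pow_two, mul_assoc] using this

/-- A symmetric function of two variables that vanishes on the diagonal is critical there: its
derivative satisfies `f' (v, w) = f' (w, v)` and `f' (v, v) = 0`. -/
lemma fderiv_eq_zero_of_symm_of_diag {E : Type*} [NormedAddCommGroup E] [NormedSpace ℝ E]
    {f : E × E → ℝ} {x : E} (hf : DifferentiableAt ℝ f (x, x)) (hsymm : ∀ y z, f (y, z) = f (z, y))
    (hdiag : ∀ᶠ y in 𝓝 x, f (y, y) = 0) : fderiv ℝ f (x, x) = 0 := by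
  have hd := hf.hasFDerivAt
  set f' := fderiv ℝ f (x, x)
  have hswap : ∀ v w, f' (v, w) = f' (w, v) := by
    have h1 : HasFDerivAt (fun p : E × E ↦ f (p.2, p.1))
        (f'.comp ((ContinuousLinearMap.snd ℝ E E).prod (ContinuousLinearMap.fst ℝ E E))) (x, x) :=
      HasFDerivAt.comp (f := fun p : E × E ↦ (p.2, p.1)) (x, x) hd
        (hasFDerivAt_snd.prodMk hasFDerivAt_fst)
    have h2 : (fun p : E × E ↦ f (p.2, p.1)) = f := funext fun p ↦ hsymm _ _
    rw [h2] at h1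
    intro v w
    exact DFunLike.congr_fun (hd.unique h1) (v, w)
  have hdiag' : ∀ v, f' (v, v) = 0 := by
    have h1 : HasFDerivAt (fun y : E ↦ f (y, y))
        (f'.comp ((ContinuousLinearMap.id ℝ E).prod (ContinuousLinearMap.id ℝ E))) x :=
      HasFDerivAt.comp (f := fun y : E ↦ (y, y)) x hd ((hasFDerivAt_id x).prodMk (hasFDerivAt_id x))
    have h2 : HasFDerivAt (fun y : E ↦ f (y, y)) (0 : E →L[ℝ] ℝ) x :=
      (hasFDerivAt_const (0 : ℝ) x).congr_of_eventuallyEq hdiag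
    intro v
    exact DFunLike.congr_fun (h1.unique h2) v
  ext v
  · have h := hdiag' v
    have h3 : f' (v, v) = f' (v, 0) + f' (0, v) := by rw [← map_add]; simp
    have := hswap v 0
    simp; linarith
  · have h := hdiag' v
    have h3 : f' (v, v) = f' (v, 0) + f' (0, v) := by rw [← map_add]; simp
    have := hswap v 0
    simp; linarith

/-! ### The normalising factor `D` -/

lemma Real.contDiffAt_Gamma {x : ℝ} (hx : 0 < x) {n : WithTop ℕ∞} :
    ContDiffAt ℝ n Real.Gamma x := by
  have hs : IsOpen {z : ℂ | 0 < z.re} := isOpen_lt continuous_const Complex.continuous_re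
  have hd : DifferentiableOn ℂ Complex.Gamma {z : ℂ | 0 < z.re} := fun z hz ↦
    (Complex.differentiableAt_Gamma z fun m hm ↦ by
      have h : 0 < z.re := hz
      rw [hm] at h
      simp at h
      linarith [(Nat.cast_nonneg m : (0 : ℝ) ≤ m)]).differentiableWithinAt
  exact ((hd.analyticAt (hs.mem_nhds (by simpa using hx))).contDiffAt).real_of_complex

lemma Real.sin_pi_mul_pos {x : ℝ} (hx : x ∈ Set.Ioo 0 1) : 0 < Real.sin (Real.pi * x) :=
  Real.sin_pos_of_pos_of_lt_pi (mul_pos Real.pi_pos hx.1)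
    (mul_lt_of_lt_one_right Real.pi_pos hx.2)

lemma mbmD_comm (x y : ℝ) : mbmD x y = mbmD y x := by
  unfold mbmD
  rw [add_comm x y]
  congr 2
  ring

lemma mbmD_num_pos {x y : ℝ} (hx : x ∈ Set.Ioo 0 1) (hy : y ∈ Set.Ioo 0 1) :
     0 < (Real.Gamma (2 * x + 1) * Real.Gamma (2 * y + 1)) *
      Real.sin (Real.pi * x) * Real.sin (Real.pi * y) :=
  mul_pos (mul_pos (mul_pos (Real.Gamma_pos_of_pos (by linarith [hx.1]))
    (Real.Gamma_pos_of_pos (by linarith [hy.1]))) (Real.sin_pi_mul_pos hx)) (Real.sin_pi_mul_pos hy)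

lemma mbmD_den_pos {x y : ℝ} (hx : x ∈ Set.Ioo 0 1) (hy : y ∈ Set.Ioo 0 1) :
    0 < 2 * Real.Gamma (x + y + 1) * Real.sin (Real.pi * (x + y) / 2) := by
  have h := Real.sin_pi_mul_pos (x := (x + y) / 2)
    ⟨by linarith [hx.1, hy.1], by linarith [hx.2, hy.2]⟩
  rw [← mul_div_assoc] at h
  have := Real.Gamma_pos_of_pos (s := x + y + 1) (by linarith [hx.1, hy.1])
  positivity

lemma mbmD_pos {x y : ℝ} (hx : x ∈ Set.Ioo 0 1) (hy : y ∈ Set.Ioo 0 1) :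
    0 < mbmD x y :=
  div_pos (Real.sqrt_pos.2 (mbmD_num_pos hx hy)) (mbmD_den_pos hx hy)

lemma contDiffAt_mbmD {x y : ℝ} (hx : x ∈ Set.Ioo 0 1) (hy : y ∈ Set.Ioo 0 1)
    {n : WithTop ℕ∞} : ContDiffAt ℝ n (fun p : ℝ × ℝ ↦ mbmD p.1 p.2) (x, y) := by
  have hG : ∀ {f : ℝ × ℝ → ℝ}, ContDiffAt ℝ n f (x, y) → 0 < f (x, y) →
      ContDiffAt ℝ n (fun p ↦ Real.Gamma (f p)) (x, y) := fun hf h ↦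
    (Real.contDiffAt_Gamma h).comp _ hf
  unfold mbmD
  refine ContDiffAt.div (ContDiffAt.sqrt ?_ (mbmD_num_pos hx hy).ne') ?_ (mbmD_den_pos hx hy).ne'
  · refine (((hG (by fun_prop) ?_).mul (hG (by fun_prop) ?_)).mul (by fun_prop)).mul (by fun_prop)
    · simp only; linarith [hx.1]
    · simp only; linarith [hy.1]
  · refine (contDiffAt_const.mul (hG (by fun_prop) ?_)).mul (by fun_prop)
    simp only; linarith [hx.1, hy.1]

lemma mbmD_self {x : ℝ} (hx : x ∈ Set.Ioo 0 1) : mbmD x x = 1 / 2 := by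
  have h1 : 0 < Real.Gamma (2 * x + 1) := Real.Gamma_pos_of_pos (by linarith [hx.1])
  have h2 := Real.sin_pi_mul_pos hx
  unfold mbmD
  rw [show (Real.Gamma (2 * x + 1) * Real.Gamma (2 * x + 1)) * Real.sin (Real.pi * x) *
      Real.sin (Real.pi * x) = (Real.Gamma (2 * x + 1) * Real.sin (Real.pi * x)) ^ 2 by ring,
    Real.sqrt_sq (by positivity), ← two_mul, show Real.pi * (2 * x) / 2 = Real.pi * x by ring,
    div_eq_iff (by positivity)]
  ring

/-! ### The variance of increments -/

/-- The variance of `B_a - B_b` without its increment term `2 D ^ K |a - b| ^ ((x + y) K)`, as a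
function of `p = ((a, x), (b, y))`, where `x` and `y` stand for the Hurst parameters `H a` and `H b`.
Treating these as independent variables makes it a smooth function, whatever the regularity of `H`. -/
noncomputable def bmbmRemainder (K : ℝ) (p : (ℝ × ℝ) × (ℝ × ℝ)) : ℝ :=
  p.1.1 ^ (2 * p.1.2 * K) + p.2.1 ^ (2 * p.2.2 * K)
    - 2 * mbmD p.1.2 p.2.2 ^ K * (p.1.1 ^ (p.1.2 + p.2.2) + p.2.1 ^ (p.1.2 + p.2.2)) ^ K

lemma bmbmRemainder_self {K a x : ℝ} (ha : 0 < a) (hx : x ∈ Set.Ioo 0 1) :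
    bmbmRemainder K ((a, x), (a, x)) = 0 := by
  have h : (2 * a ^ (2 * x)) ^ K = 2 ^ K * a ^ (2 * x * K) := by
    rw [Real.mul_rpow (by norm_num) (by positivity), ← Real.rpow_mul ha.le]
  have h2 : ((1 : ℝ) / 2) ^ K * 2 ^ K = 1 := by
    rw [← Real.mul_rpow (by norm_num) (by norm_num)]; norm_num
  simp only [bmbmRemainder]
  rw [mbmD_self hx, ← two_mul, ← two_mul, ← two_mul, h]
  linear_combination (-2 * a ^ (2 * x * K)) * h2

lemma contDiffAt_bmbmRemainder {K a x : ℝ} (ha : 0 < a) (hx : x ∈ Set.Ioo 0 1)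
    {n : WithTop ℕ∞} : ContDiffAt ℝ n (bmbmRemainder K) ((a, x), (a, x)) := by
  have hD : ContDiffAt ℝ n (fun p : (ℝ × ℝ) × (ℝ × ℝ) ↦ mbmD p.1.2 p.2.2) ((a, x), (a, x)) :=
    ContDiffAt.comp (f := fun p : (ℝ × ℝ) × (ℝ × ℝ) ↦ (p.1.2, p.2.2)) ((a, x), (a, x))
      (contDiffAt_mbmD hx hx) (by fun_prop)
  unfold bmbmRemainder
  refine ContDiffAt.sub (ContDiffAt.add ?_ ?_) (ContDiffAt.mul (ContDiffAt.mul ?_ ?_) ?_)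
  · exact ContDiffAt.rpow (by fun_prop) (by fun_prop) ha.ne'
  · exact ContDiffAt.rpow (by fun_prop) (by fun_prop) ha.ne'
  · fun_prop
  · exact hD.rpow contDiffAt_const (mbmD_pos hx hx).ne'
  · refine ContDiffAt.rpow (ContDiffAt.add ?_ ?_) contDiffAt_const ?_
    · exact ContDiffAt.rpow (by fun_prop) (by fun_prop) ha.ne'
    · exact ContDiffAt.rpow (by fun_prop) (by fun_prop) ha.ne'
    · have := Real.rpow_pos_of_pos ha (x + x)
      simp only
      positivity

/-- The remainder has no first-order part at the diagonal, being symmetric in its two pairs and zero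
when they agree. -/
lemma bmbmRemainder_isBigO {K a x : ℝ} (ha : 0 < a) (hx : x ∈ Set.Ioo 0 1) :
    bmbmRemainder K =O[𝓝 ((a, x), (a, x))] fun q ↦ ‖q - ((a, x), (a, x))‖ ^ 2 := by
  refine (contDiffAt_bmbmRemainder ha hx).isBigO_norm_sub_sq (bmbmRemainder_self ha hx)
    (fderiv_eq_zero_of_symm_of_diag
      ((contDiffAt_bmbmRemainder (n := 1) ha hx).differentiableAt (by simp)) ?_ ?_)
  · intro y z
    simp only [bmbmRemainder]
    rw [mbmD_comm z.2 y.2, add_comm z.2 y.2, add_comm (z.1 ^ (2 * z.2 * K)),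
      add_comm (z.1 ^ (y.2 + z.2))]
  · have : ∀ᶠ y : ℝ × ℝ in 𝓝 (a, x), y ∈ Set.Ioi (0 : ℝ) ×ˢ Set.Ioo (0 : ℝ) 1 :=
      (isOpen_Ioi.prod isOpen_Ioo).mem_nhds ⟨ha, hx⟩
    filter_upwards [this] with y hy
    exact bmbmRemainder_self hy.1 hy.2

/-- The variance of `B_a - B_b` is the remainder plus the increment term. -/
lemma bmbmCov_variogram {H : ℝ≥0 → ℝ} {K : ℝ} (hK : 0 < K) (hH : ∀ t, H t ∈ Set.Ioo 0 1)
    (a b : ℝ≥0) :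
    bmbmCov H K a a + bmbmCov H K b b - 2 * bmbmCov H K a b =
      bmbmRemainder K ((a, H a), (b, H b)) +
        2 * mbmD (H a) (H b) ^ K * |(a : ℝ) - b| ^ ((H a + H b) * K) := by
  have hself : ∀ a, bmbmCov H K a a = (a : ℝ) ^ (2 * H a * K) := fun a ↦ by
    have h2 : ((1 : ℝ) / 2) ^ K * 2 ^ K = 1 := by
      rw [← Real.mul_rpow (by norm_num) (by norm_num)]; norm_num
    have h3 : (0 : ℝ) < 2 * H a * K := by have := (hH a).1; positivity
    unfold bmbmCov
    rw [mbmD_self (hH a), sub_self, abs_zero, ← two_mul, ← two_mul, Real.zero_rpow h3.ne', sub_zero,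
      Real.mul_rpow (by norm_num) (by positivity), ← Real.rpow_mul a.coe_nonneg, ← mul_assoc, h2,
      one_mul]
  rw [hself, hself]
  simp only [bmbmCov, bmbmRemainder]
  ring

/-! ### Small-scale limits -/

lemma NNReal.tendsto_coe_nhdsGT_zero :
    Tendsto ((↑) : ℝ≥0 → ℝ) (𝓝[>] 0) (𝓝[>] 0) := by
  refine tendsto_nhdsWithin_iff.2 ⟨?_, ?_⟩
  · exact (NNReal.continuous_coe.tendsto' 0 0 rfl).mono_left nhdsWithin_le_nhds
  · filter_upwards [self_mem_nhdsWithin] with ρ hρ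
    exact NNReal.coe_pos.2 hρ

/-- A power with a varying exponent `e ρ` scales like the one with limiting exponent `e₀`, because
`ρ ^ (e ρ - e₀) = exp (log ρ * (e ρ - e₀))` and `log ρ * ρ ^ β → 0`. The value `c = 0` is allowed,
and there `e₀ ≠ 0` is needed. -/
lemma tendsto_mul_rpow_div_rpow {e : ℝ≥0 → ℝ} {e₀ β : ℝ} (he₀ : e₀ ≠ 0) (hβ : 0 < β)
    (he : (fun ρ ↦ e ρ - e₀) =O[𝓝[>] 0] fun ρ ↦ (ρ : ℝ) ^ β) (c : ℝ≥0) :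
    Tendsto (fun ρ : ℝ≥0 ↦ ((ρ : ℝ) * c) ^ e ρ / (ρ : ℝ) ^ e₀) (𝓝[>] 0) (𝓝 ((c : ℝ) ^ e₀)) := by
  have hβ0 : Tendsto (fun ρ : ℝ≥0 ↦ (ρ : ℝ) ^ β) (𝓝[>] 0) (𝓝 0) :=
    (((Real.continuous_rpow_const hβ.le).tendsto' 0 0 (Real.zero_rpow hβ.ne')).mono_left
      nhdsWithin_le_nhds).comp NNReal.tendsto_coe_nhdsGT_zero
  have hlim : Tendsto e (𝓝[>] 0) (𝓝 e₀) := by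
    simpa using (he.trans_tendsto hβ0).add_const e₀
  have hlog : Tendsto (fun ρ : ℝ≥0 ↦ Real.log ρ * (e ρ - e₀)) (𝓝[>] 0) (𝓝 0) :=
    ((Asymptotics.isBigO_refl (fun ρ : ℝ≥0 ↦ Real.log ρ) _).mul he).trans_tendsto
      ((tendsto_log_mul_rpow_nhdsGT_zero hβ).comp NNReal.tendsto_coe_nhdsGT_zero)
  have h1 : Tendsto (fun ρ : ℝ≥0 ↦ Real.exp (Real.log ρ * (e ρ - e₀)) * (c : ℝ) ^ e ρ) (𝓝[>] 0)
      (𝓝 (1 * (c : ℝ) ^ e₀)) :=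
    ((Real.continuous_exp.tendsto' 0 1 Real.exp_zero).comp hlog).mul
      ((Real.continuousAt_const_rpow' he₀).tendsto.comp hlim)
  rw [one_mul] at h1
  refine h1.congr' ?_
  filter_upwards [self_mem_nhdsWithin] with ρ hρ
  have hρ' : (0 : ℝ) < ρ := NNReal.coe_pos.2 hρ
  rw [← Real.rpow_def_of_pos hρ', Real.rpow_sub hρ', Real.mul_rpow hρ'.le c.coe_nonneg]
  ring

open Asymptotics in
lemma HolderWith.isBigO_comp_add_mul {C β : ℝ≥0} {H : ℝ≥0 → ℝ} (hH : HolderWith C β H)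
    (t u : ℝ≥0) :
    (fun ρ : ℝ≥0 ↦ H (t + ρ * u) - H t) =O[𝓝[>] 0] fun ρ : ℝ≥0 ↦ (ρ : ℝ) ^ (β : ℝ) := by
  refine IsBigO.of_bound (C * (u : ℝ) ^ (β : ℝ)) (Eventually.of_forall fun ρ ↦ ?_)
  have h := hH.dist_le (t + ρ * u) t
  rw [Real.dist_eq, NNReal.dist_eq] at h
  push_cast at h
  rw [add_sub_cancel_left, abs_of_nonneg (a := (ρ : ℝ) * u) (by positivity),
    Real.mul_rpow ρ.coe_nonneg u.coe_nonneg] at h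
  rw [Real.norm_eq_abs, Real.norm_of_nonneg (by positivity)]
  linarith

open Asymptotics in
/-- Away from time `0` the remainder is negligible: with `γ = min 1 β` the points
`(t + ρ u, H (t + ρ u))` are within `O(ρ ^ γ)` of `(t, H t)`, so the remainder is `O(ρ ^ (2 γ))`,
and `H t * K < γ`. -/
lemma tendsto_bmbmRemainder_of_pos {H : ℝ≥0 → ℝ} {K : ℝ} (hK1 : K ≤ 1)
    (hH : ∀ t, H t ∈ Set.Ioo 0 1) {C β : ℝ≥0} (hβ : 0 < β) (hHolder : HolderWith C β H)
    {t : ℝ≥0} (ht : 0 < t) (hlt : H t < β) (u v : ℝ≥0) :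
    Tendsto (fun ρ : ℝ≥0 ↦ bmbmRemainder K ((((t + ρ * u : ℝ≥0) : ℝ), H (t + ρ * u)),
      (((t + ρ * v : ℝ≥0) : ℝ), H (t + ρ * v))) / (ρ : ℝ) ^ (2 * (H t * K))) (𝓝[>] 0) (𝓝 0) := by
  set γ : ℝ := min 1 β with hγ
  have hγ0 : 0 < γ := lt_min one_pos (NNReal.coe_pos.2 hβ)
  have hlt' : H t * K < γ := lt_of_le_of_lt (mul_le_of_le_one_right (hH t).1.le hK1)
    (lt_min (hH t).2 hlt)
  have hpow : ∀ s : ℝ, γ ≤ s →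
      (fun ρ : ℝ≥0 ↦ (ρ : ℝ) ^ s) =O[𝓝[>] 0] fun ρ : ℝ≥0 ↦ (ρ : ℝ) ^ γ := fun s hs ↦ by
    refine IsBigO.of_bound 1 ?_
    filter_upwards [self_mem_nhdsWithin,
      nhdsWithin_le_nhds (Iic_mem_nhds (show (0 : ℝ≥0) < 1 from one_pos))] with ρ hρ hρ1
    rw [one_mul, Real.norm_of_nonneg (by positivity), Real.norm_of_nonneg (by positivity)]
    exact Real.rpow_le_rpow_of_exponent_ge (NNReal.coe_pos.2 hρ) (by exact_mod_cast hρ1) hs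
  have hcoord : ∀ w : ℝ≥0, (fun ρ : ℝ≥0 ↦
      ((((t + ρ * w : ℝ≥0) : ℝ), H (t + ρ * w)) - ((t : ℝ), H t) : ℝ × ℝ)) =O[𝓝[>] 0]
        fun ρ : ℝ≥0 ↦ (ρ : ℝ) ^ γ := fun w ↦ by
    refine IsBigO.prod_left ?_ ((hHolder.isBigO_comp_add_mul t w).trans
      (hpow _ (min_le_right _ _)))
    refine IsBigO.trans ?_ (hpow 1 (min_le_left _ _))
    refine IsBigO.of_bound (w : ℝ) (Eventually.of_forall fun ρ ↦ le_of_eq ?_)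
    simp [mul_comm]
  have hsub := (hcoord u).prod_left (hcoord v)
  have hzero : Tendsto (fun ρ : ℝ≥0 ↦ (ρ : ℝ) ^ γ) (𝓝[>] 0) (𝓝 0) :=
    (((Real.continuous_rpow_const hγ0.le).tendsto' 0 0 (Real.zero_rpow hγ0.ne')).mono_left
      nhdsWithin_le_nhds).comp NNReal.tendsto_coe_nhdsGT_zero
  have hlim : Tendsto (fun ρ : ℝ≥0 ↦ ((((t + ρ * u : ℝ≥0) : ℝ), H (t + ρ * u)),
      (((t + ρ * v : ℝ≥0) : ℝ), H (t + ρ * v)))) (𝓝[>] 0)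
      (𝓝 (((t : ℝ), H t), ((t : ℝ), H t))) :=
    tendsto_sub_nhds_zero_iff.1 (hsub.trans_tendsto hzero)
  have hmain := ((bmbmRemainder_isBigO (K := K) (NNReal.coe_pos.2 ht) (hH t)).comp_tendsto
    hlim).trans (hsub.norm_left.pow 2)
  have hexp : 0 < 2 * γ - 2 * (H t * K) := by linarith
  have hzero' : Tendsto (fun ρ : ℝ≥0 ↦ (ρ : ℝ) ^ (2 * γ - 2 * (H t * K))) (𝓝[>] 0) (𝓝 0) :=
    (((Real.continuous_rpow_const hexp.le).tendsto' 0 0 (Real.zero_rpow hexp.ne')).mono_left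
      nhdsWithin_le_nhds).comp NNReal.tendsto_coe_nhdsGT_zero
  have hdiv := hmain.mul (isBigO_refl (fun ρ : ℝ≥0 ↦ ((ρ : ℝ) ^ (2 * (H t * K)))⁻¹) (𝓝[>] 0))
  refine (hdiv.trans_tendsto (hzero'.congr' ?_)).congr fun ρ ↦ (div_eq_mul_inv _ _).symm
  filter_upwards [self_mem_nhdsWithin] with ρ hρ
  have hρ' : (0 : ℝ) < ρ := NNReal.coe_pos.2 hρ
  rw [Real.rpow_sub hρ', ← Real.rpow_natCast, ← Real.rpow_mul hρ'.le, div_eq_mul_inv,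
    mul_comm γ]
  norm_num

lemma tendsto_mbmD_rpow {H : ℝ≥0 → ℝ} (K : ℝ) (hH : ∀ t, H t ∈ Set.Ioo 0 1)
    (hcont : Continuous H) (t u v : ℝ≥0) :
    Tendsto (fun ρ : ℝ≥0 ↦ mbmD (H (t + ρ * u)) (H (t + ρ * v)) ^ K) (𝓝[>] 0)
      (𝓝 ((1 / 2) ^ K)) := by
  have hlim : ∀ w : ℝ≥0, Tendsto (fun ρ : ℝ≥0 ↦ H (t + ρ * w)) (𝓝[>] 0) (𝓝 (H t)) := fun w ↦
    ((hcont.comp (by fun_prop : Continuous fun ρ : ℝ≥0 ↦ t + ρ * w)).tendsto' 0 _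
      (by simp)).mono_left nhdsWithin_le_nhds
  rw [← mbmD_self (hH t)]
  exact (((contDiffAt_mbmD (n := 0) (hH t) (hH t)).continuousAt.tendsto.comp
    ((hlim u).prodMk_nhds (hlim v)))).rpow_const (Or.inl (mbmD_pos (hH t) (hH t)).ne')

/-- At time `0` with `K = 1` the remainder is not smooth, but each of its terms scales as a power, and
their limits cancel because `2 D(H 0, H 0) = 1`. -/
lemma tendsto_bmbmRemainder_zero {H : ℝ≥0 → ℝ} (hH : ∀ t, H t ∈ Set.Ioo 0 1) {C β : ℝ≥0}
    (hβ : 0 < β) (hHolder : HolderWith C β H) (u v : ℝ≥0) :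
    Tendsto (fun ρ : ℝ≥0 ↦ bmbmRemainder 1 ((((0 + ρ * u : ℝ≥0) : ℝ), H (0 + ρ * u)),
      (((0 + ρ * v : ℝ≥0) : ℝ), H (0 + ρ * v))) / (ρ : ℝ) ^ (2 * (H 0 * 1))) (𝓝[>] 0) (𝓝 0) := by
  have hO := hHolder.isBigO_comp_add_mul 0
  have hterm : ∀ x y w : ℝ≥0, Tendsto (fun ρ : ℝ≥0 ↦
      ((ρ : ℝ) * w) ^ (H (0 + ρ * x) + H (0 + ρ * y)) / (ρ : ℝ) ^ (2 * H 0)) (𝓝[>] 0)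
      (𝓝 ((w : ℝ) ^ (2 * H 0))) := fun x y w ↦
    tendsto_mul_rpow_div_rpow (mul_pos two_pos (hH 0).1).ne' (NNReal.coe_pos.2 hβ)
      (((hO x).add (hO y)).congr_left fun ρ ↦ by ring) w
  have h := ((hterm u u u).add (hterm v v v)).sub
    (((tendsto_mbmD_rpow 1 hH (hHolder.continuous hβ) 0 u v).const_mul 2).mul
      ((hterm u v u).add (hterm u v v)))
  rw [show (u : ℝ) ^ (2 * H 0) + (v : ℝ) ^ (2 * H 0) - 2 * (1 / 2 : ℝ) ^ (1 : ℝ) *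
    ((u : ℝ) ^ (2 * H 0) + (v : ℝ) ^ (2 * H 0)) = 0 by rw [Real.rpow_one]; ring] at h
  refine h.congr fun ρ ↦ ?_
  simp only [bmbmRemainder, zero_add, NNReal.coe_mul, mul_one, Real.rpow_one, two_mul]
  ring

/-- The rescaled variance of `B_{t + ρ u} - B_{t + ρ v}` converges to that of the increment of
`2 ^ ((1 - K) / 2)` times a fractional Brownian motion with Hurst parameter `H t * K`. -/
theorem tendsto_bmbmCov_variogram {H : ℝ≥0 → ℝ} {K : ℝ} (hK0 : 0 < K) (hK1 : K ≤ 1)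
    (hH : ∀ t, H t ∈ Set.Ioo 0 1) {C β : ℝ≥0} (hβ : 0 < β) (hHolder : HolderWith C β H)
    {t : ℝ≥0} (ht : 0 < t ∨ K = 1) (hlt : H t < β) (u v : ℝ≥0) :
    Tendsto (fun ρ : ℝ≥0 ↦ (bmbmCov H K (t + ρ * u) (t + ρ * u) +
        bmbmCov H K (t + ρ * v) (t + ρ * v) - 2 * bmbmCov H K (t + ρ * u) (t + ρ * v)) /
        (ρ : ℝ) ^ (2 * (H t * K))) (𝓝[>] 0)
      (𝓝 (2 ^ (1 - K) * |(u : ℝ) - v| ^ (2 * (H t * K)))) := by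
  have hrem : Tendsto (fun ρ : ℝ≥0 ↦ bmbmRemainder K ((((t + ρ * u : ℝ≥0) : ℝ), H (t + ρ * u)),
      (((t + ρ * v : ℝ≥0) : ℝ), H (t + ρ * v))) / (ρ : ℝ) ^ (2 * (H t * K))) (𝓝[>] 0) (𝓝 0) := by
    rcases eq_zero_or_pos t with rfl | ht0
    · obtain rfl : K = 1 := ht.resolve_left (lt_irrefl _)
      exact tendsto_bmbmRemainder_zero hH hβ hHolder u v
    · exact tendsto_bmbmRemainder_of_pos hK1 hH hβ hHolder ht0 hlt u v
  have hinc : Tendsto (fun ρ : ℝ≥0 ↦ ((ρ : ℝ) * (nndist (u : ℝ) v : ℝ≥0)) ^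
      ((H (t + ρ * u) + H (t + ρ * v)) * K) / (ρ : ℝ) ^ (2 * (H t * K))) (𝓝[>] 0)
      (𝓝 (((nndist (u : ℝ) v : ℝ≥0) : ℝ) ^ (2 * (H t * K)))) := by
    refine tendsto_mul_rpow_div_rpow (mul_pos two_pos (mul_pos (hH t).1 hK0)).ne'
      (NNReal.coe_pos.2 hβ) ?_ _
    exact (((hHolder.isBigO_comp_add_mul t u).add (hHolder.isBigO_comp_add_mul t v)).const_mul_left
      K).congr_left fun ρ ↦ by ring
  have h := hrem.add (((tendsto_mbmD_rpow K hH (hHolder.continuous hβ) t u v).const_mul 2).mul hinc)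
  have h2 : 2 * (1 / 2 : ℝ) ^ K = 2 ^ (1 - K) := by
    rw [Real.rpow_sub two_pos, Real.rpow_one, one_div, Real.inv_rpow two_pos.le, div_eq_mul_inv]
  rw [zero_add, h2, coe_nndist, Real.dist_eq] at h
  refine h.congr fun ρ ↦ ?_
  have habs : |((t + ρ * u : ℝ≥0) : ℝ) - (t + ρ * v : ℝ≥0)| = (ρ : ℝ) * |(u : ℝ) - v| := by
    push_cast
    rw [add_sub_add_left_eq_sub, ← mul_sub, abs_mul, abs_of_nonneg ρ.coe_nonneg]
  rw [bmbmCov_variogram hK0 hH, habs]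
  ring

/-! ### Local asymptotic self-similarity -/

/-- Polarisation: covariances of increments in terms of variances of increments. -/
lemma IsCentredGaussian.covariance_increment {Ω : Type*} [MeasurableSpace Ω] {P : Measure Ω}
    [IsProbabilityMeasure P] {R : ℝ≥0 → ℝ≥0 → ℝ} {Z : ℝ≥0 → Ω → ℝ} (hZ : IsCentredGaussian R Z P)
    (t a b : ℝ≥0) :
    cov[fun ω ↦ Z a ω - Z t ω, fun ω ↦ Z b ω - Z t ω; P] =
      ((R a a + R t t - 2 * R a t) + (R b b + R t t - 2 * R b t)
        - (R a a + R b b - 2 * R a b)) / 2 := by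
  have hL : ∀ s, MemLp (Z s) 2 P := fun s ↦ (hZ.gaussian.hasGaussianLaw_eval s).memLp_two
  rw [covariance_fun_sub_fun_sub (hL a) (hL t) (hL b) (hL t), covariance_comm (Z t) (Z b)]
  simp only [hZ.cov_eq]
  ring

theorem proposition3
    {Ω : Type*} [MeasurableSpace Ω] (P : Measure Ω) [IsProbabilityMeasure P]
    (K : ℝ) (hK0 : 0 < K) (hK1 : K ≤ 1)
    (H : ℝ≥0 → ℝ) (μ ν : ℝ) (hμ : 0 < μ) (hν : ν < 1) (hH : ∀ t, H t ∈ Set.Icc μ ν)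
    (β : ℝ≥0) (hβ : 0 < β) (hHolder : ∃ C : ℝ≥0, HolderWith C β H)
    (hsup : (⨆ t, H t) < (β : ℝ))
    (B : ℝ≥0 → Ω → ℝ) (hB : IsBMBm H K B P)
    (t : ℝ≥0) (ht : 0 < t ∨ K = 1)
    {Ω' : Type*} [MeasurableSpace Ω'] (P' : Measure Ω') [IsProbabilityMeasure P']
    (Z : ℝ≥0 → Ω' → ℝ) (hZ : IsFBm (H t * K) Z P') :
    TendstoFDD
      (fun (ρ : ℝ≥0) (u : ℝ≥0) (ω : Ω) ↦ (B (t + ρ * u) ω - B t ω) / (ρ : ℝ) ^ (H t * K))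
      (𝓝[>] 0)
      (fun (u : ℝ≥0) (ω : Ω') ↦ (2 : ℝ) ^ ((1 - K) / 2) * Z u ω)
      P P' := by
  obtain ⟨C, hC⟩ := hHolder
  have hH01 : ∀ s, H s ∈ Set.Ioo 0 1 := fun s ↦
    ⟨hμ.trans_le (hH s).1, (hH s).2.trans_lt hν⟩
  have hlt : H t < β :=
    (le_ciSup ⟨ν, Set.forall_mem_range.2 fun s ↦ (hH s).2⟩ t).trans_lt hsup
  have hBint : ∀ s, Integrable (B s) P := fun s ↦ (hB.gaussian.hasGaussianLaw_eval s).integrable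
  have h2K : ((2 : ℝ) ^ ((1 - K) / 2)) ^ 2 = 2 ^ (1 - K) := by
    rw [← Real.rpow_natCast, ← Real.rpow_mul two_pos.le]
    norm_num
  refine tendstoFDD_of_tendsto_covariance (fun ρ ↦ ?_) (fun ρ u ↦ ?_) ?_ (fun u ↦ ?_) fun u v ↦ ?_
  · have h := ((hB.gaussian.shift t).comp_right (fun u : ℝ≥0 ↦ ρ * u)).smul
      fun _ ↦ ((ρ : ℝ) ^ (H t * K))⁻¹
    simpa only [Function.comp_def, smul_eq_mul, inv_mul_eq_div] using h
  · rw [integral_div, integral_sub (hBint _) (hBint _), hB.centred, hB.centred]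
    simp
  · exact hZ.gaussian.smul fun _ ↦ (2 : ℝ) ^ ((1 - K) / 2)
  · rw [integral_const_mul, hZ.centred, mul_zero]
  · -- `B_t` is `B_{t + ρ * 0}`, so each variance in the polarisation identity is an instance of `hv`.
    have hv := fun a b ↦ tendsto_bmbmCov_variogram hK0 hK1 hH01 hβ hC ht hlt a b
    have h := (((hv u 0).add (hv v 0)).sub (hv u v)).div_const 2
    have hlimit : cov[fun ω ↦ (2 : ℝ) ^ ((1 - K) / 2) * Z u ω,
        fun ω ↦ (2 : ℝ) ^ ((1 - K) / 2) * Z v ω; P'] =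
        (2 ^ (1 - K) * |(u : ℝ) - (0 : ℝ≥0)| ^ (2 * (H t * K)) +
          2 ^ (1 - K) * |(v : ℝ) - (0 : ℝ≥0)| ^ (2 * (H t * K)) -
          2 ^ (1 - K) * |(u : ℝ) - v| ^ (2 * (H t * K))) / 2 := by
      rw [covariance_const_mul_left, covariance_const_mul_right, hZ.cov_eq, fbmCov, ← h2K]
      simp only [NNReal.coe_zero, sub_zero, NNReal.abs_eq]
      ring
    rw [hlimit]
    refine h.congr' ?_
    filter_upwards [self_mem_nhdsWithin] with ρ hρ
    have hρ' : (0 : ℝ) < ρ := NNReal.coe_pos.2 hρ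
    rw [covariance_fun_div_left, covariance_fun_div_right,
      IsCentredGaussian.covariance_increment hB]
    have hpow : (ρ : ℝ) ^ (2 * (H t * K)) = (ρ : ℝ) ^ (H t * K) * (ρ : ℝ) ^ (H t * K) := by
      rw [← Real.rpow_add hρ', two_mul]
    rw [hpow, div_div]
    simp only [mul_zero, add_zero]
    ring
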